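/- All graphs are finite and simple. For a connected graph $G$ let $\tau(G)$ be the number of spanning trees of $G$ and, for an edge $e$, let $\tau_G(e)$ be the number of spanning trees of $G$ that contain $e$. Put $d_G(e)=\tau_G(e)/\tau(G)$ and $\mathrm{dep}(G)=\max_{e\in E(G)}d_G(e)$. Given graphs $G_1,\dots,G_n$ with chosen edges $e_i=u_iv_i\in E(G_i)$, the necklace graph $N(G_1,\dots,G_n)$ is obtained from their disjoint union by identifying $v_i$ with $u_{i+1}$ for every $i$ (indices modulo $n$). $K_{r,s}$ is the complete bipartite graph with partite sets of sizes $r$ and $s$. (1) Let $p<q$ be positive integers and let $t_2,\dots,t_n$ be positive integers with $$\sum_{i=2}^n\frac1{t_i}=\frac p{q-p}\quad\text{and}\quad t_i\ge\frac qp\quad(2\le i\le n).$$ (These conditions force $n\ge 3$.) Let $r_i=2t_i$ and $s_i=2t_i-1$ for $2\le i\le n$. Then, for every choice of the edges $e_i=u_iv_i$, the graph $G=N(K_{1,1},K_{r_2,s_2},\dots,K_{r_n,s_n})$ is connected, $e_1$ is an edge of $G$, and $$\mathrm{dep}(G)=d_G(e_1)=\frac pq .$$ If moreover $n$ is even, then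 $G$ is bipartite. (2) For all positive integers $p<q$ there are an even $n$ and positive integers $t_2,\dots,t_n$ that satisfy the two conditions in (1). (3) Consequently, for all positive integers $p<q$ there is a connected bipartite graph $G$ with $\mathrm{dep}(G)=p/q$. (4) Also, Kahl's Conjecture 1 holds: there is a function $f(p,q)$ such that for all positive integers $p<q$ and all positive integers $t_2,\dots,t_n$ with $\sum_{i=2}^n 1/t_i=p/(q-p)$ and $t_i\ge f(p,q)$ for $2\le i\le n$, the graph $G=N(K_{1,1},K_{2t_2,2t_2-1},\dots,K_{2t_n,2t_n-1})$ satisfies $\mathrm{dep}(G)=d_G(e_1)$, for every choice of the edges $e_i$. -/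

import Mathlib

/-- The spanning trees of `G`: the spanning subgraphs of `G` that are trees. -/
def spanningTrees {V : Type*} (G : SimpleGraph V) : Set (SimpleGraph V) :=
  {T | T ≤ G ∧ T.IsTree}

/-- `τ(G)`, the number of spanning trees of a (finite) graph `G`. -/
noncomputable def numSpanningTrees {V : Type*} (G : SimpleGraph V) : ℕ :=
  (spanningTrees G).ncard

/-- `τ_G(e)`, the number of spanning trees of a (finite) graph `G` that contain the edge `e`. -/
noncomputable def numSpanningTreesThrough {V : Type*} (G : SimpleGraph V) (e : Sym2 V) : ℕ :=
  {T ∈ spanningTrees G | e ∈ T.edgeSet}.ncard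

/-- The spanning tree edge density `d_G(e) = τ_G(e) / τ(G)`. -/
noncomputable def edgeDensity {V : Type*} (G : SimpleGraph V) (e : Sym2 V) : ℝ :=
  (numSpanningTreesThrough G e : ℝ) / (numSpanningTrees G : ℝ)

/-- The spanning tree edge dependence `dep(G)`, the largest density of an edge of `G`.
For a finite graph with an edge the supremum is a maximum, see `dependence_isGreatest`. -/
noncomputable def dependence {V : Type*} (G : SimpleGraph V) : ℝ :=
  sSup (edgeDensity G '' G.edgeSet)

theorem dependence_isGreatest {V : Type*} [Finite V] (G : SimpleGraph V)
    (h : G.edgeSet.Nonempty) : IsGreatest (edgeDensity G '' G.edgeSet) (dependence G) :=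
  ⟨(h.image _).csSup_mem (Set.toFinite _),
    fun _ hx => le_csSup (Set.toFinite (edgeDensity G '' G.edgeSet)).bddAbove hx⟩

/-- The vertices of the necklace graph of `n` pairwise disjoint beads with vertex types `W i` and
key vertices `u i`, `v i`: the disjoint union of the `W i`, in which `v i` is identified with
`u (i + 1)` for every `i`, the indices being taken modulo `n`. -/
def NecklaceVertex {n : ℕ} [NeZero n] {W : Fin n → Type*} (u v : ∀ i, W i) : Type _ :=
  Quot (fun x y : Σ i, W i => ∃ i, x = ⟨i, v i⟩ ∧ y = ⟨i + 1, u (i + 1)⟩)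

/-- The vertex `a` of the bead `i`, as a vertex of the necklace graph. -/
def NecklaceVertex.mk {n : ℕ} [NeZero n] {W : Fin n → Type*} (u v : ∀ i, W i)
    (i : Fin n) (a : W i) : NecklaceVertex u v :=
  Quot.mk _ ⟨i, a⟩

/-- The necklace graph of the graphs `H i` with key edges `u i v i`: two distinct vertices are
adjacent if they come from adjacent vertices of one bead. For `n ≥ 3` no two edges of the beads
become parallel, so that the simple graph records all of them. -/
def necklace {n : ℕ} [NeZero n] {W : Fin n → Type*} (H : ∀ i, SimpleGraph (W i))
    (u v : ∀ i, W i) : SimpleGraph (NecklaceVertex u v) where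
  Adj x y := x ≠ y ∧ ∃ (i : Fin n) (a b : W i), (H i).Adj a b ∧
    x = NecklaceVertex.mk u v i a ∧ y = NecklaceVertex.mk u v i b
  symm := ⟨fun _ _ ⟨hne, i, a, b, hab, hx, hy⟩ => ⟨hne.symm, i, b, a, hab.symm, hy, hx⟩⟩
  loopless := ⟨fun _ h => h.1 rfl⟩

/-- The key edge of the bead `i`, as an edge of the necklace graph. -/
def keyEdge {n : ℕ} [NeZero n] {W : Fin n → Type*} (u v : ∀ i, W i) (i : Fin n) :
    Sym2 (NecklaceVertex u v) :=
  s(NecklaceVertex.mk u v i (u i), NecklaceVertex.mk u v i (v i))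

/-- The sizes `r` of the first partite sets: `1` for the first bead and then `2 t i`. -/
def sizeR {m : ℕ} (t : Fin m → ℕ) : Fin (m + 1) → ℕ :=
  Fin.cons 1 (fun i => 2 * t i)

/-- The sizes `s` of the second partite sets: `1` for the first bead and then `2 t i - 1`. -/
def sizeS {m : ℕ} (t : Fin m → ℕ) : Fin (m + 1) → ℕ :=
  Fin.cons 1 (fun i => 2 * t i - 1)

/-- The beads `K_{1,1}, K_{2 t i, 2 t i - 1}`; there are `n = m + 1` of them. -/
def bead {m : ℕ} (t : Fin m → ℕ) (i : Fin (m + 1)) :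
    SimpleGraph (Fin (sizeR t i) ⊕ Fin (sizeS t i)) :=
  completeBipartiteGraph (Fin (sizeR t i)) (Fin (sizeS t i))

/-!
Regard every edge of a connected graph `G` as a unit resistor. The proof rests on Kirchhoff's
theorem `exists_isUnitPotential_edgeDensity`: the density `d_G(ab)` of an edge is the effective
resistance between its ends, the potential drop `φ a - φ b` of a unit current from `a` to `b`. The
potential is found by counting forests. Up to the factor `τ(G)`, let `φ x` be the number of
spanning forests with two components, separating `a` from `b`, in which `x` lies on the side of `a`.
Such a forest that separates `x` from `y` as well becomes a spanning tree when an edge `xy` is added,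
so that the divergence of the current at `x` can be computed tree by tree; and in a tree exactly one
edge at `x` leads towards any other given vertex
(`IsTree.existsUnique_adj_reachable_deleteEdges`).

Potentials are handled through the Dirichlet form, which for a necklace with at least three beads is
the sum of the Dirichlet forms of the beads (`dirichletForm_necklace`). This has two consequences.
The density of an edge in the necklace is at most its density in its bead, by the Cauchy–Schwarz
inequality (`edgeDensity_necklace_le`). The density of `e₁` is the resistance of the bead `K_{1,1}`,
that is, `1`, in parallel with the sum of the resistances of the other beads between their key
vertices, because the potentials of the beads can be scaled and shifted so that they agree at the
key vertices (`edgeDensity_keyEdge_zero`).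

An explicit potential on `K_{r,s}` shows that every edge has resistance `(r + s - 1) / (r s)`, which
is `1 / t` for `r = 2t` and `s = 2t - 1`. With `∑ 1 / tᵢ = p / (q - p)` the density of `e₁` is thus
`(p / (q - p)) / (q / (q - p)) = p / q`, and every other edge has density at most `1 / tᵢ ≤ p / q`.
-/

namespace SimpleGraph

/-! ### Separating forests and spanning trees -/

section Trees

variable {V : Type*} {G T F : SimpleGraph V} {a b x y z : V}

/-- The spanning forests of `G` with exactly two components, one containing `a` and the other
containing `b`. -/
def separatingForests (G : SimpleGraph V) (a b : V) : Set (SimpleGraph V) :=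
  {F | F ≤ G ∧ F.IsAcyclic ∧ ¬ F.Reachable a b ∧ ∀ z, F.Reachable a z ∨ F.Reachable b z}

theorem mem_separatingForests_congr (hx : F.Reachable a x) (hy : F.Reachable b y) :
    F ∈ separatingForests G a b ↔ F ∈ separatingForests G x y := by
  have h1 : ∀ z, F.Reachable a z ↔ F.Reachable x z :=
    fun z => ⟨fun h => hx.symm.trans h, fun h => hx.trans h⟩
  have h2 : ∀ z, F.Reachable b z ↔ F.Reachable y z :=
    fun z => ⟨fun h => hy.symm.trans h, fun h => hy.trans h⟩
  have h3 : F.Reachable a b ↔ F.Reachable x y :=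
    ⟨fun h => hx.symm.trans (h.trans hy), fun h => hx.trans (h.trans hy.symm)⟩
  simp only [separatingForests, Set.mem_ofPred_eq, h1, h2]
  rw [← h1 b, h3]

theorem separatingForests_comm : separatingForests G a b = separatingForests G b a := by
  ext F
  simp only [separatingForests, Set.mem_ofPred_eq, reachable_comm (u := a) (v := b),
    or_comm (a := F.Reachable a _)]

theorem IsTree.deleteEdges_mem_separatingForests (hT : T.IsTree) (hTG : T ≤ G)
    (hxy : T.Adj x y) : T.deleteEdges {s(x, y)} ∈ separatingForests G x y := by
  refine ⟨(deleteEdges_le _).trans hTG, hT.isAcyclic.anti (deleteEdges_le _),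
    isBridge_iff.1 (isAcyclic_iff_forall_adj_isBridge.1 hT.isAcyclic hxy), fun z => ?_⟩
  obtain ⟨p⟩ := hT.connected.preconnected z x
  induction p with
  | nil => exact .inl .rfl
  | @cons u v w h p ih =>
    by_cases he : s(u, v) = s(w, y)
    · rcases Sym2.eq_iff.1 he with ⟨rfl, _⟩ | ⟨rfl, _⟩
      · exact .inl .rfl
      · exact .inr .rfl
    · have hvu : (T.deleteEdges {s(w, y)}).Adj v u := by
        simp [deleteEdges_adj, h.symm, Sym2.eq_swap (a := v), he]
      exact (ih hxy).imp (fun h => h.trans hvu.reachable) (fun h => h.trans hvu.reachable)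

theorem sup_edge_isTree_of_mem_separatingForests (hF : F ∈ separatingForests G x y) :
    (F ⊔ edge x y).IsTree := by
  obtain ⟨-, hac, hn, hz⟩ := hF
  have hne : x ≠ y := by rintro rfl; exact hn .rfl
  have hadj : (F ⊔ edge x y).Adj x y := by simp [edge_adj, hne]
  refine ⟨?_, hac.sup_edge_of_not_reachable hn⟩
  rw [connected_iff_exists_forall_reachable]
  refine ⟨x, fun z => ?_⟩
  rcases hz z with h | h
  · exact h.mono le_sup_left
  · exact hadj.reachable.trans (h.mono le_sup_left)

theorem deleteEdges_sup_edge_of_not_adj (h : ¬ F.Adj x y) :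
    (F ⊔ edge x y).deleteEdges {s(x, y)} = F := by
  rw [deleteEdges_sup, deleteEdges_edge (Set.mem_singleton _), sup_bot_eq, deleteEdges_eq_self]
  simpa

/-- In a tree, exactly one edge at `x` leads towards a vertex `z ≠ x`. -/
theorem IsTree.existsUnique_adj_reachable_deleteEdges (hT : T.IsTree) (hxz : x ≠ z) :
    ∃! y, T.Adj x y ∧ (T.deleteEdges {s(x, y)}).Reachable y z := by
  classical
  obtain ⟨p, hp, huniq⟩ := hT.existsUnique_path x z
  cases p with
  | nil => exact absurd rfl hxz
  | @cons _ y _ h p =>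
    rw [Walk.cons_isPath_iff] at hp
    refine ⟨y, ⟨h, ?_⟩, ?_⟩
    · rw [reachable_deleteEdges_iff_exists_walk]
      exact ⟨p, fun he => hp.2 (p.fst_mem_support_of_mem_edges he)⟩
    · rintro y' ⟨h', hr⟩
      obtain ⟨q, hq⟩ := hr.exists_isPath
      have hxq : x ∉ q.support := fun hx =>
        isBridge_iff.1 (isAcyclic_iff_forall_adj_isBridge.1 hT.isAcyclic h')
          (q.takeUntil x hx).reachable.symm
      have hpath : (Walk.cons h' (q.mapLe (deleteEdges_le _))).IsPath := by
        rw [Walk.cons_isPath_iff]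
        exact ⟨hq.mapLe _, by simpa using hxq⟩
      have := congrArg Walk.snd (huniq _ hpath)
      simpa using this

theorem IsAcyclic.not_adj_and_reachable_deleteEdges_self (hT : T.IsAcyclic) :
    ¬ (T.Adj x y ∧ (T.deleteEdges {s(x, y)}).Reachable y x) := fun h =>
  isBridge_iff.1 (isAcyclic_iff_forall_adj_isBridge.1 hT h.1) h.2.symm

variable [Fintype V]

open scoped Classical in
theorem IsTree.sum_adj_reachable_deleteEdges (hT : T.IsTree) (x z : V) :
    (∑ y, if T.Adj x y ∧ (T.deleteEdges {s(x, y)}).Reachable y z then (1 : ℝ) else 0) =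
      if x = z then 0 else 1 := by
  split_ifs with hxz
  · subst hxz
    exact Finset.sum_eq_zero fun y _ => if_neg hT.isAcyclic.not_adj_and_reachable_deleteEdges_self
  · obtain ⟨y, hy, hu⟩ := hT.existsUnique_adj_reachable_deleteEdges hxz
    rw [Finset.sum_eq_single y (fun w _ hw => if_neg fun h => hw (hu w h)) (by simp), if_pos hy]

open scoped Classical in
/-- Removing the edge `xy` is a bijection from the spanning trees through `xy` to the forests
separating `x` and `y`. -/
theorem sum_separatingForests (h : G.Adj x y) (g : SimpleGraph V → ℝ) :
    (∑ F : SimpleGraph V, if F ∈ separatingForests G x y then g F else 0) =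
      ∑ T : SimpleGraph V, if T ∈ spanningTrees G ∧ T.Adj x y then
        g (T.deleteEdges {s(x, y)}) else 0 := by
  rw [← Finset.sum_filter, ← Finset.sum_filter]
  have hn : ∀ F ∈ separatingForests G x y, ¬ F.Adj x y := fun F hF hadj => hF.2.2.1 hadj.reachable
  refine Finset.sum_bij' (fun F _ => F ⊔ edge x y) (fun T _ => T.deleteEdges {s(x, y)})
    ?_ ?_ ?_ ?_ ?_
  · intro F hF
    rw [Finset.mem_filter_univ] at hF ⊢
    refine ⟨⟨sup_le hF.1 ((edge_le_iff _).2 (.inr h)), sup_edge_isTree_of_mem_separatingForests hF⟩,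
      ?_⟩
    simp [edge_adj, h.ne]
  · intro T hT
    rw [Finset.mem_filter_univ] at hT ⊢
    exact hT.1.2.deleteEdges_mem_separatingForests hT.1.1 hT.2
  · intro F hF
    rw [Finset.mem_filter_univ] at hF
    exact deleteEdges_sup_edge_of_not_adj (hn F hF)
  · intro T hT
    rw [Finset.mem_filter_univ] at hT
    ext u v
    simp only [sup_adj, deleteEdges_adj, Set.mem_singleton_iff, edge_adj, Sym2.eq_iff]
    have := hT.2
    have := hT.2.symm
    have := hT.2.ne
    grind
  · intro F hF
    rw [Finset.mem_filter_univ] at hF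
    rw [deleteEdges_sup_edge_of_not_adj (hn F hF)]

open scoped Classical in
/-- The number of forests separating `a` and `b` in which `x` lies on the side of `a`. Up to the
factor `τ(G)`, this is the potential at `x` of a unit current from `a` to `b`. -/
noncomputable def forestCount (G : SimpleGraph V) (a b x : V) : ℝ :=
  ∑ F : SimpleGraph V, if F ∈ separatingForests G a b ∧ F.Reachable a x then 1 else 0

open scoped Classical in
/-- A forest contributes to the potential drop from `x` to `y` only if it separates `x` and `y`
as well as `a` and `b`; its sign tells which of `a`, `b` lies on the side of `y`. -/
theorem forestCount_sub_forestCount (G : SimpleGraph V) (a b x y : V) :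
    forestCount G a b x - forestCount G a b y =
      ∑ F : SimpleGraph V, if F ∈ separatingForests G x y then
        ((if F.Reachable y b then (1 : ℝ) else 0) - if F.Reachable y a then 1 else 0) else 0 := by
  rw [forestCount, forestCount, ← Finset.sum_sub_distrib]
  refine Finset.sum_congr rfl fun F _ => ?_
  by_cases hab : F ∈ separatingForests G a b
  · have hn := hab.2.2.1
    have hsep : ∀ u v, F ∈ separatingForests G u v → ¬ F.Reachable u v := fun u v h => h.2.2.1
    rcases hab.2.2.2 x with hx | hx <;> rcases hab.2.2.2 y with hy | hy
    · have : F ∉ separatingForests G x y := fun h => hsep _ _ h (hx.symm.trans hy)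
      simp [hab, hx, hy, this]
    · have h1 : F ∈ separatingForests G x y := (mem_separatingForests_congr hx hy).1 hab
      have h2 : ¬ F.Reachable a y := fun h => hn (h.trans hy.symm)
      simp [hab, hx, h1, h2, hy.symm, reachable_comm (u := y) (v := a)]
    · have h1 : F ∈ separatingForests G x y := by
        rw [separatingForests_comm]
        exact (mem_separatingForests_congr hy hx).1 hab
      have h2 : ¬ F.Reachable a x := fun h => hn (h.trans hx.symm)
      have h3 : ¬ F.Reachable y b := fun h => hn (hy.trans h)
      simp [hab, h1, h2, hy, h3, hy.symm]
    · have h0 : F ∉ separatingForests G x y := fun h => hsep _ _ h (hx.symm.trans hy)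
      have h1 : ¬ F.Reachable a x := fun h => hn (h.trans hx.symm)
      have h2 : ¬ F.Reachable a y := fun h => hn (h.trans hy.symm)
      simp [h0, h1, h2]
  · by_cases hxy : F ∈ separatingForests G x y
    · have key : F.Reachable y b ↔ F.Reachable y a := by
        constructor
        · intro hb
          rcases hxy.2.2.2 a with ha | ha
          · exact absurd ((mem_separatingForests_congr ha hb).1 hxy) hab
          · exact ha
        · intro ha
          rcases hxy.2.2.2 b with hb | hb
          · rw [separatingForests_comm] at hxy
            exact absurd ((mem_separatingForests_congr ha hb).1 hxy) hab
          · exact hb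
      simp [hab, hxy, key]
    · simp [hab, hxy]

open scoped Classical in
theorem numSpanningTrees_eq_sum (G : SimpleGraph V) :
    (numSpanningTrees G : ℝ) = ∑ T : SimpleGraph V, if T ∈ spanningTrees G then 1 else 0 := by
  rw [numSpanningTrees, Finset.sum_boole, Set.ncard_eq_toFinset_card']
  congr 2
  ext; simp

open scoped Classical in
theorem numSpanningTreesThrough_eq_sum (G : SimpleGraph V) (a b : V) :
    (numSpanningTreesThrough G s(a, b) : ℝ) =
      ∑ T : SimpleGraph V, if T ∈ spanningTrees G ∧ T.Adj a b then 1 else 0 := by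
  rw [numSpanningTreesThrough, Finset.sum_boole, Set.ncard_eq_toFinset_card']
  congr 2
  ext; simp

theorem forestCount_sub_forestCount_self (h : G.Adj a b) :
    forestCount G a b a - forestCount G a b b = numSpanningTreesThrough G s(a, b) := by
  classical
  rw [forestCount_sub_forestCount, numSpanningTreesThrough_eq_sum, sum_separatingForests h]
  refine Finset.sum_congr rfl fun T _ => ?_
  split_ifs with hT h1 h2
  · exact absurd ⟨hT.2, h2⟩ hT.1.2.isAcyclic.not_adj_and_reachable_deleteEdges_self
  · simp
  all_goals simp_all

open scoped Classical in
/-- The current with potential `forestCount G a b` obeys Kirchhoff's node law: every spanning tree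
contributes a unit current from `a` to `b`. -/
theorem sum_adj_forestCount_sub (G : SimpleGraph V) (a b x : V) :
    (∑ y, if G.Adj x y then forestCount G a b x - forestCount G a b y else 0) =
      numSpanningTrees G * ((if x = a then 1 else 0) - if x = b then 1 else 0) := by
  have h1 : ∀ y, (if G.Adj x y then forestCount G a b x - forestCount G a b y else 0) =
      ∑ T : SimpleGraph V, if T ∈ spanningTrees G then
        ((if T.Adj x y ∧ (T.deleteEdges {s(x, y)}).Reachable y b then (1 : ℝ) else 0) -
          if T.Adj x y ∧ (T.deleteEdges {s(x, y)}).Reachable y a then 1 else 0) else 0 := by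
    intro y
    split_ifs with hxy
    · rw [forestCount_sub_forestCount, sum_separatingForests hxy]
      refine Finset.sum_congr rfl fun T _ => ?_
      by_cases hT : T ∈ spanningTrees G
      · by_cases hA : T.Adj x y
        · simp only [hT, hA, and_self, true_and, if_true]
          congr!
        · simp [hA]
      · simp [hT]
    · refine (Finset.sum_eq_zero fun T _ => ?_).symm
      by_cases hT : T ∈ spanningTrees G
      · have : ¬ T.Adj x y := fun h => hxy (hT.1 h)
        simp [this]
      · simp [hT]
  rw [Finset.sum_congr rfl fun y _ => h1 y, Finset.sum_comm, numSpanningTrees_eq_sum,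
    Finset.sum_mul]
  refine Finset.sum_congr rfl fun T _ => ?_
  by_cases hT : T ∈ spanningTrees G
  · simp only [hT, if_true, Finset.sum_sub_distrib, one_mul]
    rw [hT.2.sum_adj_reachable_deleteEdges, hT.2.sum_adj_reachable_deleteEdges]
    split_ifs <;> norm_num
  · simp [hT]

end Trees

/-! ### Dirichlet energy and unit potentials -/

section Energy

variable {V : Type*} [Fintype V] {G : SimpleGraph V} {a b : V} {φ ψ : V → ℝ}

open scoped Classical in
/-- The Dirichlet form of `G`: the sum of `(φ x - φ y) * (χ x - χ y)` over the edges `xy`. The sum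
below runs over ordered pairs, so that it meets every edge twice. -/
noncomputable def dirichletForm (G : SimpleGraph V) (φ χ : V → ℝ) : ℝ :=
  (∑ x, ∑ y, if G.Adj x y then (φ x - φ y) * (χ x - χ y) else 0) / 2

theorem dirichletForm_comm (G : SimpleGraph V) (φ χ : V → ℝ) :
    dirichletForm G φ χ = dirichletForm G χ φ := by
  simp only [dirichletForm, mul_comm]

theorem dirichletForm_self_nonneg (G : SimpleGraph V) (φ : V → ℝ) : 0 ≤ dirichletForm G φ φ := by
  classical
  refine div_nonneg (Finset.sum_nonneg fun x _ => Finset.sum_nonneg fun y _ => ?_) zero_le_two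
  split_ifs
  · exact mul_self_nonneg _
  · exact le_rfl

theorem dirichletForm_mul_left (G : SimpleGraph V) (c : ℝ) (φ χ : V → ℝ) :
    dirichletForm G (fun x => c * φ x) χ = c * dirichletForm G φ χ := by
  classical
  simp only [dirichletForm, mul_div_assoc', Finset.mul_sum]
  congr 1
  refine Finset.sum_congr rfl fun x _ => Finset.sum_congr rfl fun y _ => ?_
  split_ifs <;> ring

theorem dirichletForm_add_const_left (G : SimpleGraph V) (k : ℝ) (φ χ : V → ℝ) :
    dirichletForm G (fun x => φ x + k) χ = dirichletForm G φ χ := by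
  simp [dirichletForm]

theorem dirichletForm_sub_mul_self (G : SimpleGraph V) (c : ℝ) (φ ψ : V → ℝ) :
    dirichletForm G (fun x => φ x - c * ψ x) (fun x => φ x - c * ψ x) =
      dirichletForm G φ φ - 2 * c * dirichletForm G ψ φ + c ^ 2 * dirichletForm G ψ ψ := by
  classical
  simp only [dirichletForm, mul_div_assoc', Finset.mul_sum, ← add_div, ← sub_div,
    ← Finset.sum_add_distrib, ← Finset.sum_sub_distrib]
  congr 1
  refine Finset.sum_congr rfl fun x _ => Finset.sum_congr rfl fun y _ => ?_
  split_ifs <;> ring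

open scoped Classical in
theorem dirichletForm_eq_sum_mul (G : SimpleGraph V) (φ χ : V → ℝ) :
    dirichletForm G φ χ = ∑ x, (∑ y, if G.Adj x y then φ x - φ y else 0) * χ x := by
  rw [dirichletForm, div_eq_iff two_ne_zero, mul_two]
  simp only [Finset.sum_mul]
  nth_rw 3 [Finset.sum_comm]
  simp only [← Finset.sum_add_distrib]
  refine Finset.sum_congr rfl fun x _ => Finset.sum_congr rfl fun y _ => ?_
  simp only [G.adj_comm y x]
  split_ifs <;> ring

/-- `φ` is the potential of a unit current that enters `G` at `a` and leaves it at `b`, when every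
edge is a unit resistor. Kirchhoff's node law is stated in its weak form, that is, tested against
all functions `χ`. -/
def IsUnitPotential (G : SimpleGraph V) (a b : V) (φ : V → ℝ) : Prop :=
  ∀ χ : V → ℝ, dirichletForm G φ χ = χ a - χ b

theorem isUnitPotential_of_sum_adj [DecidableEq V] [DecidableRel G.Adj]
    (h : ∀ x, (∑ y, if G.Adj x y then φ x - φ y else 0) =
      (if x = a then (1 : ℝ) else 0) - if x = b then 1 else 0) : IsUnitPotential G a b φ := by
  intro χ
  rw [dirichletForm_eq_sum_mul]
  trans ∑ x, ((if x = a then (1 : ℝ) else 0) - if x = b then 1 else 0) * χ x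
  · refine Finset.sum_congr rfl fun x _ => ?_
    rw [← h x]
    congr!
  · simp [sub_mul, Finset.sum_sub_distrib]

theorem IsUnitPotential.symm (h : IsUnitPotential G a b φ) :
    IsUnitPotential G b a (fun x => -1 * φ x) := by
  intro χ
  rw [dirichletForm_mul_left, h]
  ring

/-- The effective resistance does not depend on the choice of the potential. -/
theorem IsUnitPotential.sub_eq_sub (hφ : IsUnitPotential G a b φ) (hψ : IsUnitPotential G a b ψ) :
    φ a - φ b = ψ a - ψ b := by
  rw [← hψ φ, ← hφ ψ, dirichletForm_comm]

/-- Dirichlet's principle: the energy of `φ` is at least its squared drop divided by the effective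
resistance. It is the Cauchy–Schwarz inequality between `φ` and a unit potential. -/
theorem IsUnitPotential.sq_sub_le (hψ : IsUnitPotential G a b ψ) (φ : V → ℝ) :
    (φ a - φ b) ^ 2 ≤ (ψ a - ψ b) * dirichletForm G φ φ := by
  -- the energy of `φ - c ψ` is a nonnegative quadratic polynomial in `c`
  have key : ∀ c : ℝ,
      0 ≤ (ψ a - ψ b) * (c * c) + (-2 * (φ a - φ b)) * c + dirichletForm G φ φ := by
    intro c
    have := dirichletForm_self_nonneg G (fun x => φ x - c * ψ x)
    rw [dirichletForm_sub_mul_self, hψ, hψ] at this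
    linarith
  have := discrim_le_zero key
  rw [discrim] at this
  linarith

theorem numSpanningTrees_pos (hG : G.Connected) : 0 < numSpanningTrees G := by
  obtain ⟨T, hT⟩ := hG.exists_isTree_le
  exact (Set.ncard_pos (Set.toFinite _)).2 ⟨T, hT⟩

/-- Kirchhoff's theorem: the fraction of the spanning trees that contain the edge `ab` is the
effective resistance between its ends. -/
theorem exists_isUnitPotential_edgeDensity (hG : G.Connected) (h : G.Adj a b) :
    ∃ φ, IsUnitPotential G a b φ ∧ _root_.edgeDensity G s(a, b) = φ a - φ b := by
  classical
  have hτ : (numSpanningTrees G : ℝ) ≠ 0 := by exact_mod_cast (numSpanningTrees_pos hG).ne'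
  refine ⟨fun x => forestCount G a b x / numSpanningTrees G,
    isUnitPotential_of_sum_adj fun x => ?_, ?_⟩
  · rw [← mul_right_inj' hτ, ← sum_adj_forestCount_sub, Finset.mul_sum]
    refine Finset.sum_congr rfl fun y _ => ?_
    split_ifs
    · field_simp
    · simp
  · rw [_root_.edgeDensity, ← forestCount_sub_forestCount_self h, sub_div]

theorem IsUnitPotential.edgeDensity_eq (hφ : IsUnitPotential G a b φ) (hG : G.Connected)
    (h : G.Adj a b) : _root_.edgeDensity G s(a, b) = φ a - φ b := by
  obtain ⟨ψ, hψ, he⟩ := exists_isUnitPotential_edgeDensity hG h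
  rw [he, hψ.sub_eq_sub hφ]

end Energy

end SimpleGraph

namespace SimpleGraph

/-! ### Complete bipartite graphs -/

section CompleteBipartite

variable {α β : Type*} [Fintype α] [Fintype β]

theorem isUnitPotential_completeBipartiteGraph [DecidableEq α] [DecidableEq β] (a : α) (b : β) :
    IsUnitPotential (completeBipartiteGraph α β) (.inl a) (.inr b)
      (Sum.elim
        (fun x => (if x = a then (1 : ℝ) / Fintype.card β else 0) -
          1 / (Fintype.card α * Fintype.card β))
        (fun y => if y = b then -1 / (Fintype.card α : ℝ) else 0)) := by
  classical
  have hα : (Fintype.card α : ℝ) ≠ 0 := by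
    exact_mod_cast (Fintype.card_pos_iff.2 ⟨a⟩).ne'
  have hβ : (Fintype.card β : ℝ) ≠ 0 := by
    exact_mod_cast (Fintype.card_pos_iff.2 ⟨b⟩).ne'
  apply isUnitPotential_of_sum_adj
  rintro (x | y)
  · by_cases hx : x = a <;> simp [Finset.sum_sub_distrib, hx] <;> field_simp <;> ring
  · by_cases hy : y = b <;> simp [Finset.sum_sub_distrib, hy] <;> field_simp <;> ring

/-- The effective resistance of an edge of `K_{r,s}` is `(r + s - 1) / (r s)`. -/
theorem exists_isUnitPotential_completeBipartiteGraph {x y : α ⊕ β}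
    (h : (completeBipartiteGraph α β).Adj x y) :
    ∃ φ, IsUnitPotential (completeBipartiteGraph α β) x y φ ∧
      φ x - φ y = (Fintype.card α + Fintype.card β - 1 : ℝ) /
        (Fintype.card α * Fintype.card β) := by
  classical
  have key : ∀ (a : α) (b : β), ∃ φ,
      IsUnitPotential (completeBipartiteGraph α β) (.inl a) (.inr b) φ ∧
        φ (.inl a) - φ (.inr b) = (Fintype.card α + Fintype.card β - 1 : ℝ) /
          (Fintype.card α * Fintype.card β) := by
    intro a b
    refine ⟨_, isUnitPotential_completeBipartiteGraph a b, ?_⟩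
    have hα : (Fintype.card α : ℝ) ≠ 0 := by
      exact_mod_cast (Fintype.card_pos_iff.2 ⟨a⟩).ne'
    have hβ : (Fintype.card β : ℝ) ≠ 0 := by
      exact_mod_cast (Fintype.card_pos_iff.2 ⟨b⟩).ne'
    simp only [Sum.elim_inl, Sum.elim_inr, if_true]
    field_simp
    ring
  rcases x with a | b <;> rcases y with a' | b'
  · simp at h
  · exact key a b'
  · obtain ⟨φ, hφ, hR⟩ := key a' b
    exact ⟨_, hφ.symm, by rw [← hR]; ring⟩
  · simp at h

omit [Fintype α] [Fintype β] in
theorem completeBipartiteGraph_connected [Nonempty α] [Nonempty β] :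
    (completeBipartiteGraph α β).Connected := by
  obtain ⟨a⟩ := ‹Nonempty α›
  obtain ⟨b⟩ := ‹Nonempty β›
  have hb : ∀ x : α, (completeBipartiteGraph α β).Adj (.inr b) (.inl x) := by simp
  have ha : ∀ y : β, (completeBipartiteGraph α β).Adj (.inl a) (.inr y) := by simp
  rw [connected_iff_exists_forall_reachable]
  refine ⟨.inr b, ?_⟩
  rintro (x | y)
  · exact (hb x).reachable
  · exact (hb a).reachable.trans (ha y).reachable

end CompleteBipartite

end SimpleGraph

/-! ### Necklace graphs -/

section Necklace

open SimpleGraph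

/-- A function on the cyclically ordered set `Fin (m + 1)` is the increment of another function
if its values sum to zero. -/
theorem exists_eq_add_of_sum_eq_zero {m : ℕ} (g : Fin (m + 1) → ℝ) (hg : ∑ i, g i = 0) :
    ∃ k : Fin (m + 1) → ℝ, ∀ i, k i = g (i + 1) + k (i + 1) := by
  refine ⟨fun i => ∑ j ∈ Finset.Ioi i, g j, fun i => ?_⟩
  induction i using Fin.lastCases with
  | last =>
    have h0 : (Finset.univ : Finset (Fin (m + 1))) = insert 0 (Finset.Ioi 0) := by
      ext x
      simp [em]
    have h1 : Finset.Ioi (Fin.last m) = ∅ := by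
      ext x
      simp [Fin.le_last]
    rw [h0, Finset.sum_insert (by simp)] at hg
    simp only [Fin.last_add_one, h1, hg, Finset.sum_empty]
  | cast j =>
    have : Finset.Ioi j.castSucc = insert j.succ (Finset.Ioi j.succ) := by
      ext x
      simp only [Finset.mem_Ioi, Finset.mem_insert, Fin.lt_def, Fin.ext_iff, Fin.val_castSucc,
        Fin.val_succ]
      omega
    simp only [Fin.coeSucc_eq_succ, this]
    exact Finset.sum_insert (by simp)

namespace NecklaceVertex

variable {n : ℕ} [NeZero n] {W : Fin n → Type*} {u v : ∀ i, W i}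

instance [∀ i, Finite (W i)] : Finite (NecklaceVertex u v) :=
  inferInstanceAs (Finite (Quot _))

theorem mk_key (i : Fin n) : mk u v i (v i) = mk u v (i + 1) (u (i + 1)) :=
  Quot.sound ⟨i, rfl, rfl⟩

theorem exists_mk (x : NecklaceVertex u v) : ∃ i a, x = mk u v i a := by
  obtain ⟨⟨i, a⟩, rfl⟩ := Quot.exists_rep x
  exact ⟨i, a, rfl⟩

open scoped Classical in
/-- The preferred representative of a vertex of the necklace: the key vertex shared by two beads
is represented as the vertex `u` of the later one. -/
noncomputable def rep (huv : ∀ i, u i ≠ v i) : NecklaceVertex u v → Σ i, W i :=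
  Quot.lift (fun x => if x.2 = v x.1 then ⟨x.1 + 1, u (x.1 + 1)⟩ else x) <| by
    rintro _ _ ⟨i, rfl, rfl⟩
    simp [huv]

theorem eq_of_mk_eq_mk (huv : ∀ i, u i ≠ v i) {i j : Fin n} {a : W i} {b : W j}
    (h : mk u v i a = mk u v j b) :
    (⟨i, a⟩ : Σ i, W i) = ⟨j, b⟩ ∨
      (a = v i ∧ (⟨j, b⟩ : Σ i, W i) = ⟨i + 1, u (i + 1)⟩) ∨
      (b = v j ∧ (⟨i, a⟩ : Σ i, W i) = ⟨j + 1, u (j + 1)⟩) := by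
  classical
  have h := congrArg (rep huv) h
  simp only [rep, mk] at h
  split_ifs at h with ha hb hb
  · have hij : i = j := add_right_cancel (congrArg Sigma.fst h)
    subst hij
    exact .inl (by simp_all)
  · exact .inr (.inl ⟨ha, h.symm⟩)
  · exact .inr (.inr ⟨hb, h⟩)
  · exact .inl h

theorem add_one_ne_self (hn : 2 ≤ n) (i : Fin n) : i + 1 ≠ i := by
  intro h
  have h1 : (1 : Fin n) = 0 := by simpa using h
  have := congrArg Fin.val h1
  rw [Fin.val_one', Fin.val_zero, Nat.mod_eq_of_lt (by omega)] at this
  omega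

theorem add_one_add_one_ne_self (hn : 3 ≤ n) (i : Fin n) : i + 1 + 1 ≠ i := by
  intro h
  have h1 : (1 + 1 : Fin n) = 0 := by simpa [add_assoc] using h
  have := congrArg Fin.val h1
  rw [Fin.val_add, Fin.val_one', Fin.val_zero, Nat.mod_eq_of_lt (show 1 < n by omega),
    Nat.mod_eq_of_lt (by omega)] at this
  omega

theorem mk_injective (hn : 2 ≤ n) (huv : ∀ i, u i ≠ v i) (i : Fin n) :
    Function.Injective (mk u v i) := by
  intro a b h
  rcases eq_of_mk_eq_mk huv h with h | ⟨-, h⟩ | ⟨-, h⟩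
  · simpa using h
  · exact absurd (congrArg Sigma.fst h).symm (add_one_ne_self hn i)
  · exact absurd (congrArg Sigma.fst h).symm (add_one_ne_self hn i)

/-- Two different beads share at most one vertex, so that they have no parallel edges. This is
where at least three beads are needed: two beads share two vertices. -/
theorem eq_of_mk_eq_mk_of_ne (hn : 3 ≤ n) (huv : ∀ i, u i ≠ v i) {i j : Fin n} {a b : W i}
    {c d : W j} (hab : a ≠ b) (hcd : c ≠ d) (hac : mk u v i a = mk u v j c)
    (hbd : mk u v i b = mk u v j d) :
    (⟨i, a, b⟩ : Σ i, W i × W i) = ⟨j, c, d⟩ := by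
  by_cases hij : i = j
  · subst hij
    rw [mk_injective (by omega) huv i hac, mk_injective (by omega) huv i hbd]
  · have hne : ∀ (x : W i) (y : W j), (⟨i, x⟩ : Σ i, W i) ≠ ⟨j, y⟩ :=
      fun x y h => hij (congrArg Sigma.fst h)
    rcases eq_of_mk_eq_mk huv hac with h | ⟨ha, h⟩ | ⟨hc, h⟩
    · exact absurd h (hne _ _)
    all_goals rcases eq_of_mk_eq_mk huv hbd with h' | ⟨hb, h'⟩ | ⟨hd, h'⟩
    · exact absurd h' (hne _ _)
    · exact absurd (ha.trans hb.symm) hab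
    · have h1 : j = i + 1 := congrArg Sigma.fst h
      have h2 : i = j + 1 := congrArg Sigma.fst h'
      exact absurd (h1 ▸ h2).symm (add_one_add_one_ne_self hn i)
    · exact absurd h' (hne _ _)
    · have h1 : i = j + 1 := congrArg Sigma.fst h
      have h2 : j = i + 1 := congrArg Sigma.fst h'
      exact absurd (h1 ▸ h2).symm (add_one_add_one_ne_self hn j)
    · exact absurd (hc.trans hd.symm) hcd

end NecklaceVertex

open NecklaceVertex

variable {n : ℕ} [NeZero n] {W : Fin n → Type*} {H : ∀ i, SimpleGraph (W i)} {u v : ∀ i, W i}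

theorem necklace_adj_mk (hn : 2 ≤ n) (huv : ∀ i, u i ≠ v i) {i : Fin n} {a b : W i}
    (h : (H i).Adj a b) : (necklace H u v).Adj (mk u v i a) (mk u v i b) :=
  ⟨(mk_injective hn huv i).ne h.ne, i, a, b, h, rfl, rfl⟩

theorem necklace_connected (hn : 2 ≤ n) (huv : ∀ i, u i ≠ v i) (hH : ∀ i, (H i).Connected) :
    (necklace H u v).Connected := by
  have hbead : ∀ i (a b : W i), (necklace H u v).Reachable (mk u v i a) (mk u v i b) := by
    intro i a b
    exact ((hH i).preconnected a b).map ⟨mk u v i, fun h => necklace_adj_mk hn huv h⟩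
  have hkey : ∀ k : ℕ, (necklace H u v).Reachable (mk u v 0 (u 0))
      (mk u v (Fin.ofNat n k) (u (Fin.ofNat n k))) := by
    intro k
    induction k with
    | zero => exact .rfl
    | succ k ih =>
      refine ih.trans ((hbead _ _ (v _)).trans ?_)
      rw [mk_key]
      have : Fin.ofNat n k + 1 = Fin.ofNat n (k + 1) := by
        ext; simp [Fin.val_add]
      rw [this]
  rw [connected_iff_exists_forall_reachable]
  refine ⟨mk u v 0 (u 0), fun x => ?_⟩
  obtain ⟨i, a, rfl⟩ := exists_mk x
  have := hkey i
  rw [show Fin.ofNat n i = i by ext; simp] at this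
  exact this.trans (hbead i _ a)

/-- The edges of the necklace are the edges of its beads. -/
theorem dirichletForm_necklace (hn : 3 ≤ n) (huv : ∀ i, u i ≠ v i) [∀ i, Fintype (W i)]
    [Fintype (NecklaceVertex u v)] (φ χ : NecklaceVertex u v → ℝ) :
    dirichletForm (necklace H u v) φ χ =
      ∑ i, dirichletForm (H i) (fun a => φ (mk u v i a)) (fun a => χ (mk u v i a)) := by
  classical
  simp only [dirichletForm, ← Finset.sum_div, ← Fintype.sum_prod_type']
  congr 1
  rw [← Fintype.sum_sigma' (fun i (p : W i × W i) => if (H i).Adj p.1 p.2 then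
    (φ (mk u v i p.1) - φ (mk u v i p.2)) * (χ (mk u v i p.1) - χ (mk u v i p.2)) else 0),
    ← Finset.sum_filter, ← Finset.sum_filter]
  symm
  refine Finset.sum_bij (fun x _ => (mk u v x.1 x.2.1, mk u v x.1 x.2.2)) ?_ ?_ ?_ ?_
  · intro x hx
    rw [Finset.mem_filter_univ] at hx ⊢
    exact necklace_adj_mk (by omega) huv hx
  · rintro ⟨i, a, b⟩ hx ⟨j, c, d⟩ hy h
    rw [Finset.mem_filter_univ] at hx hy
    obtain ⟨h1, h2⟩ := Prod.ext_iff.1 h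
    exact eq_of_mk_eq_mk_of_ne hn huv hx.ne hy.ne h1 h2
  · rintro ⟨_, _⟩ h
    rw [Finset.mem_filter_univ] at h
    obtain ⟨-, i, a, b, hab, rfl, rfl⟩ := h
    exact ⟨⟨i, a, b⟩, by simpa using hab, rfl⟩
  · intro x _
    rfl

/-- An edge is at most as dense in the necklace as it is in its bead: by Rayleigh's monotonicity
law, the other beads can only lower the effective resistance between its ends. -/
theorem edgeDensity_necklace_le (hn : 3 ≤ n) (huv : ∀ i, u i ≠ v i)
    (hH : ∀ i, (H i).Connected) [∀ i, Fintype (W i)] {i : Fin n} {a b : W i}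
    (hab : (H i).Adj a b) {ψ : W i → ℝ} (hψ : IsUnitPotential (H i) a b ψ) :
    edgeDensity (necklace H u v) s(mk u v i a, mk u v i b) ≤ ψ a - ψ b := by
  have := Fintype.ofFinite (NecklaceVertex u v)
  obtain ⟨φ, hφ, he⟩ := exists_isUnitPotential_edgeDensity
    (necklace_connected (by omega) huv hH) (necklace_adj_mk (by omega) huv hab)
  rw [he]
  set R := φ (mk u v i a) - φ (mk u v i b) with hR
  have h1 := hψ.sq_sub_le (fun a => φ (mk u v i a))
  have h2 : dirichletForm (H i) (fun a => φ (mk u v i a)) (fun a => φ (mk u v i a)) ≤ R := by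
    rw [hR, ← hφ φ, dirichletForm_necklace hn huv]
    exact Finset.single_le_sum
      (f := fun i => dirichletForm (H i) (fun a => φ (mk u v i a)) (fun a => φ (mk u v i a)))
      (fun i _ => dirichletForm_self_nonneg _ _) (Finset.mem_univ i)
  have h3 : 0 ≤ ψ a - ψ b := hψ ψ ▸ dirichletForm_self_nonneg _ _
  have h4 : 0 ≤ R := (dirichletForm_self_nonneg _ _).trans h2
  by_contra! hlt
  have h5 : (ψ a - ψ b) * dirichletForm (H i) (fun a => φ (mk u v i a))
      (fun a => φ (mk u v i a)) ≤ (ψ a - ψ b) * R := mul_le_mul_of_nonneg_left h2 h3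
  nlinarith

/-- The density of the key edge of the first bead. In the current from one of its ends to the other,
the bead `0` and the chain of all other beads are connected in parallel; `R i` is the effective
resistance of the bead `i` between its key vertices. -/
theorem edgeDensity_keyEdge_zero {m : ℕ} {W : Fin (m + 1) → Type*} [∀ i, Fintype (W i)]
    {H : ∀ i, SimpleGraph (W i)} {u v : ∀ i, W i} (hm : 2 ≤ m)
    (huv : ∀ i, (H i).Adj (u i) (v i)) (hH : ∀ i, (H i).Connected) {ψ : ∀ i, W i → ℝ}
    (hψ : ∀ i, IsUnitPotential (H i) (u i) (v i) (ψ i)) {R : Fin (m + 1) → ℝ}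
    (hR : ∀ i, ψ i (u i) - ψ i (v i) = R i) (hpos : ∑ i, R i ≠ 0) :
    edgeDensity (necklace H u v) (keyEdge u v 0) =
      R 0 * (∑ i : Fin m, R i.succ) / ∑ i, R i := by
  classical
  have := Fintype.ofFinite (NecklaceVertex u v)
  have hne : ∀ i, u i ≠ v i := fun i => (huv i).ne
  -- `c i` is the current through the bead `i`, counted from `u i` to `v i`: it is `c 0` in the bead
  -- `0` and `c 0 - 1` in all others, and `∑ c i * R i = 0` because the potential is single-valued
  set c : Fin (m + 1) → ℝ := fun i => (if i = 0 then 1 else 0) - R 0 / ∑ i, R i with hc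
  obtain ⟨k, hk⟩ := exists_eq_add_of_sum_eq_zero (fun i => c i * R i) (by
    simp only [hc, sub_mul, Finset.sum_sub_distrib, ite_mul, one_mul, zero_mul,
      Finset.sum_ite_eq', Finset.mem_univ, if_true, ← Finset.mul_sum]
    field_simp
    ring)
  set φ : NecklaceVertex u v → ℝ :=
    Quot.lift (fun x => c x.1 * ψ x.1 x.2 + (k x.1 - c x.1 * ψ x.1 (v x.1))) (by
      rintro _ _ ⟨i, rfl, rfl⟩
      have := hk i
      rw [← hR (i + 1)] at this
      simp only [this]
      ring) with hφdef
  have hφmk : ∀ i a, φ (mk u v i a) = c i * ψ i a + (k i - c i * ψ i (v i)) := fun i a => rfl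
  have hφ : IsUnitPotential (necklace H u v) (mk u v 0 (u 0)) (mk u v 0 (v 0)) φ := by
    intro χ
    have hloop : ∑ i, (χ (mk u v i (u i)) - χ (mk u v i (v i))) = 0 := by
      rw [Finset.sum_sub_distrib, sub_eq_zero]
      simp only [mk_key]
      exact (Fintype.sum_equiv (Equiv.addRight (1 : Fin (m + 1)))
        (fun i => χ (mk u v (i + 1) (u (i + 1)))) (fun i => χ (mk u v i (u i)))
        fun i => rfl).symm
    rw [dirichletForm_necklace (by omega) hne]
    simp only [hφmk, dirichletForm_add_const_left, dirichletForm_mul_left]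
    simp only [fun i => hψ i (fun a => χ (mk u v i a))]
    simp only [hc, sub_mul, Finset.sum_sub_distrib, ← Finset.mul_sum, hloop]
    simp
  rw [keyEdge, hφ.edgeDensity_eq (necklace_connected (by omega) hne hH)
    (necklace_adj_mk (by omega) hne (huv 0)), hφmk, hφmk]
  have : c 0 * R 0 = R 0 * (∑ i : Fin m, R i.succ) / ∑ i, R i := by
    simp only [hc, if_true]
    field_simp
    rw [Fin.sum_univ_succ]
    ring
  rw [← this, ← hR]
  ring

theorem necklace_isBipartite (hn : Even n) (hH : ∀ i, (H i).IsBipartite)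
    (huv : ∀ i, (H i).Adj (u i) (v i)) : (necklace H u v).IsBipartite := by
  have C : ∀ i, (H i).Coloring Bool := fun i => (hH i).toColoring (by simp)
  have hpar : ∀ i : Fin n, (i + 1).val.bodd = !i.val.bodd := by
    intro i
    rcases (Nat.succ_le_of_lt i.2).lt_or_eq with h | h
    · rw [Fin.val_add_one_of_lt' h, Nat.bodd_succ]
    · have h0 : (i + 1).val = 0 := by
        rw [Fin.val_add, Fin.val_one', Nat.add_mod_mod, show i.val + 1 = n from h, Nat.mod_self]
      have h1 : i.val.bodd = true := by
        obtain ⟨k, hk⟩ := hn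
        have : Nat.bodd (i.val + 1) = false := by
          rw [show i.val + 1 = n from h, hk, Nat.bodd_add, Bool.xor_self]
        rw [Nat.bodd_succ] at this
        simpa using this
      simp [h0, h1]
  -- in the bead `i` the colouring gives the parity of `i` to the vertex `u i`
  let f : NecklaceVertex u v → Bool :=
    Quot.lift (fun x => xor (xor (C x.1 x.2) (C x.1 (u x.1))) x.1.val.bodd) (by
      rintro _ _ ⟨i, rfl, rfl⟩
      have h := (C i).valid (huv i)
      simp only [hpar, Bool.xor_self, Bool.false_xor]
      revert h
      cases C i (u i) <;> cases C i (v i) <;> simp)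
  have hf : (necklace H u v).Coloring Bool := Coloring.mk f (by
    rintro _ _ ⟨-, i, a, b, hab, rfl, rfl⟩
    have h := (C i).valid hab
    change xor (xor (C i a) (C i (u i))) i.val.bodd ≠ xor (xor (C i b) (C i (u i))) i.val.bodd
    simpa using h)
  simpa using hf.colorable

end Necklace

/-! ### The beads `K_{2t,2t-1}` -/

section Beads

open SimpleGraph

variable {m : ℕ} {t : Fin m → ℕ}

theorem sizeR_pos (ht : ∀ i, 0 < t i) (i : Fin (m + 1)) : 0 < sizeR t i := by
  cases i using Fin.cases with
  | zero => exact one_pos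
  | succ i =>
    have := ht i
    simp only [sizeR, Fin.cons_succ]
    omega

theorem sizeS_pos (ht : ∀ i, 0 < t i) (i : Fin (m + 1)) : 0 < sizeS t i := by
  cases i using Fin.cases with
  | zero => exact one_pos
  | succ i =>
    have := ht i
    simp only [sizeS, Fin.cons_succ]
    omega

theorem bead_connected (ht : ∀ i, 0 < t i) (i : Fin (m + 1)) : (bead t i).Connected :=
  have : Nonempty (Fin (sizeR t i)) := ⟨⟨0, sizeR_pos ht i⟩⟩
  have : Nonempty (Fin (sizeS t i)) := ⟨⟨0, sizeS_pos ht i⟩⟩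
  completeBipartiteGraph_connected

theorem bead_isBipartite (t : Fin m → ℕ) (i : Fin (m + 1)) : (bead t i).IsBipartite :=
  (CompleteBipartiteGraph.bicoloring _ _).colorable

theorem exists_bead_adj (ht : ∀ i, 0 < t i) :
    ∃ u v : ∀ i : Fin (m + 1), Fin (sizeR t i) ⊕ Fin (sizeS t i),
      ∀ i, (bead t i).Adj (u i) (v i) :=
  ⟨fun i => .inl ⟨0, sizeR_pos ht i⟩, fun i => .inr ⟨0, sizeS_pos ht i⟩, fun i => by simp [bead]⟩

/-- The effective resistance of an edge of the bead `i`: it is `1` for the bead `K_{1,1}` and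
`1 / t` for `K_{2t,2t-1}`. -/
noncomputable def beadResistance (t : Fin m → ℕ) : Fin (m + 1) → ℝ :=
  Fin.cons 1 (fun i => 1 / t i)

theorem exists_isUnitPotential_bead (ht : ∀ i, 0 < t i) {i : Fin (m + 1)}
    {x y : Fin (sizeR t i) ⊕ Fin (sizeS t i)} (h : (bead t i).Adj x y) :
    ∃ φ, IsUnitPotential (bead t i) x y φ ∧ φ x - φ y = beadResistance t i := by
  obtain ⟨φ, hφ, hR⟩ := exists_isUnitPotential_completeBipartiteGraph h
  refine ⟨φ, hφ, hR.trans ?_⟩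
  rw [Fintype.card_fin, Fintype.card_fin]
  clear * - ht
  cases i using Fin.cases with
  | zero => simp [sizeR, sizeS, beadResistance]
  | succ i =>
    have h1 : 1 ≤ t i := ht i
    have h2 : (1 : ℝ) ≤ t i := by exact_mod_cast h1
    simp only [sizeR, sizeS, beadResistance, Fin.cons_succ]
    rw [Nat.cast_sub (by omega)]
    push_cast
    have h3 : (2 * (t i : ℝ) - 1) ≠ 0 := by linarith
    have h4 : (t i : ℝ) ≠ 0 := by linarith
    field_simp
    ring

/-! ### The dependence of the necklace -/

variable {p q : ℕ}

/-- The two conditions on the `t i` cannot be met with fewer than three beads. -/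
theorem two_le_of_sum_eq (hp : 0 < p) (hpq : p < q)
    (hsum : ∑ i, (1 : ℝ) / (t i : ℝ) = (p : ℝ) / ((q : ℝ) - (p : ℝ)))
    (hle : ∀ i, (q : ℝ) / (p : ℝ) ≤ (t i : ℝ)) : 2 ≤ m := by
  have hp' : (0 : ℝ) < p := by exact_mod_cast hp
  have hpq' : (0 : ℝ) < q - p := sub_pos.2 (by exact_mod_cast hpq)
  have hlt : (p : ℝ) / q < p / (q - p) := div_lt_div_of_pos_left hp' hpq' (by linarith)
  have hq' : (0 : ℝ) < q := by linarith
  have hle' : ∑ i, (1 : ℝ) / (t i : ℝ) ≤ m * (p / q) := by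
    have := Finset.sum_le_sum (s := Finset.univ) fun i _ =>
      one_div_le_one_div_of_le (div_pos hq' hp') (hle i)
    simpa using this
  by_contra! hm
  have hm' : (m : ℝ) ≤ 1 := by exact_mod_cast Nat.le_of_lt_succ hm
  have := mul_le_mul_of_nonneg_right hm' (div_nonneg hp'.le hq'.le)
  linarith

theorem edgeDensity_necklace_bead_keyEdge (hp : 0 < p) (hpq : p < q) (ht : ∀ i, 0 < t i)
    (hsum : ∑ i, (1 : ℝ) / (t i : ℝ) = (p : ℝ) / ((q : ℝ) - (p : ℝ)))
    (hm : 2 ≤ m) {u v : ∀ i : Fin (m + 1), Fin (sizeR t i) ⊕ Fin (sizeS t i)}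
    (huv : ∀ i, (bead t i).Adj (u i) (v i)) :
    edgeDensity (necklace (bead t) u v) (keyEdge u v 0) = (p : ℝ) / (q : ℝ) := by
  have hp' : (0 : ℝ) < p := by exact_mod_cast hp
  have hpq' : (0 : ℝ) < q - p := sub_pos.2 (by exact_mod_cast hpq)
  have hq' : (0 : ℝ) < q := by linarith
  choose ψ hψ hR using fun i => exists_isUnitPotential_bead ht (huv i)
  have h1 : ∑ i : Fin m, beadResistance t i.succ = p / (q - p) := by
    simpa [beadResistance] using hsum
  have h2 : ∑ i, beadResistance t i = q / (q - p) := by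
    rw [Fin.sum_univ_succ, h1, beadResistance, Fin.cons_zero]
    field_simp
    ring
  rw [edgeDensity_keyEdge_zero hm huv (bead_connected ht) hψ hR (by rw [h2]; positivity), h1, h2,
    beadResistance, Fin.cons_zero]
  field_simp

/-- The only edge of the bead `K_{1,1}` is its key edge. -/
theorem mk_eq_keyEdge_zero {u v : ∀ i : Fin (m + 1), Fin (sizeR t i) ⊕ Fin (sizeS t i)}
    (huv : (bead t 0).Adj (u 0) (v 0)) {a b : Fin (sizeR t 0) ⊕ Fin (sizeS t 0)}
    (hab : (bead t 0).Adj a b) :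
    s(NecklaceVertex.mk u v 0 a, NecklaceVertex.mk u v 0 b) = keyEdge u v 0 := by
  have : Subsingleton (Fin (sizeR t 0)) := inferInstanceAs (Subsingleton (Fin 1))
  have : Subsingleton (Fin (sizeS t 0)) := inferInstanceAs (Subsingleton (Fin 1))
  have key : s(a, b) = s(u 0, v 0) := by
    generalize u 0 = x at huv
    generalize v 0 = y at huv
    rcases a with a | a <;> rcases b with b | b <;> rcases x with x | x <;> rcases y with y | y <;>
      simp [bead] at hab huv <;> simp [eq_iff_true_of_subsingleton]
  simpa [keyEdge] using congrArg (Sym2.map (NecklaceVertex.mk u v 0)) key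

theorem dependence_necklace_bead (hp : 0 < p) (hpq : p < q) (ht : ∀ i, 0 < t i)
    (hsum : ∑ i, (1 : ℝ) / (t i : ℝ) = (p : ℝ) / ((q : ℝ) - (p : ℝ)))
    (hle : ∀ i, (q : ℝ) / (p : ℝ) ≤ (t i : ℝ))
    {u v : ∀ i : Fin (m + 1), Fin (sizeR t i) ⊕ Fin (sizeS t i)}
    (huv : ∀ i, (bead t i).Adj (u i) (v i)) :
    (necklace (bead t) u v).Connected ∧
      keyEdge u v 0 ∈ (necklace (bead t) u v).edgeSet ∧
      dependence (necklace (bead t) u v) = edgeDensity (necklace (bead t) u v) (keyEdge u v 0) ∧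
      edgeDensity (necklace (bead t) u v) (keyEdge u v 0) = (p : ℝ) / (q : ℝ) := by
  have hm := two_le_of_sum_eq hp hpq hsum hle
  have hne : ∀ i, u i ≠ v i := fun i => (huv i).ne
  have hkey : keyEdge u v 0 ∈ (necklace (bead t) u v).edgeSet :=
    necklace_adj_mk (by omega) hne (huv 0)
  have hd := edgeDensity_necklace_bead_keyEdge hp hpq ht hsum hm huv
  refine ⟨necklace_connected (by omega) hne (bead_connected ht), hkey, ?_, hd⟩
  refine (dependence_isGreatest _ ⟨_, hkey⟩).unique ⟨⟨_, hkey, rfl⟩, ?_⟩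
  rintro _ ⟨e, he, rfl⟩
  induction e using Sym2.inductionOn with
  | hf x y =>
    obtain ⟨-, i, a, b, hab, rfl, rfl⟩ := he
    cases i using Fin.cases with
    | zero => rw [mk_eq_keyEdge_zero (huv 0) hab]
    | succ i =>
      obtain ⟨ψ, hψ, hR⟩ := exists_isUnitPotential_bead ht hab
      refine (edgeDensity_necklace_le (by omega) hne (bead_connected ht) hab hψ).trans ?_
      have hp' : (0 : ℝ) < p := by exact_mod_cast hp
      have hq' : (0 : ℝ) < q := by exact_mod_cast hp.trans hpq
      rw [hR, hd, beadResistance, Fin.cons_succ, ← one_div_div (q : ℝ)]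
      exact one_div_le_one_div_of_le (div_pos hq' hp') (hle i)

/-! ### The choice of the `t i` -/

/-- Take `p q` terms `1 / ((q - p) q)`; if their number is even, split one of them into halves. -/
theorem exists_odd_sum_one_div_eq (hp : 0 < p) (hpq : p < q) :
    ∃ (m : ℕ) (t : Fin m → ℕ), Even (m + 1) ∧ (∀ i, 0 < t i) ∧
      ∑ i, (1 : ℝ) / (t i : ℝ) = (p : ℝ) / ((q : ℝ) - (p : ℝ)) ∧
      ∀ i, (q : ℝ) / (p : ℝ) ≤ (t i : ℝ) := by
  have hpq' : (0 : ℝ) < q - p := sub_pos.2 (by exact_mod_cast hpq)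
  have hq' : (0 : ℝ) < q := by exact_mod_cast hp.trans hpq
  have hT : 0 < (q - p) * q := Nat.mul_pos (by omega) (by omega)
  have hTc : (((q - p) * q : ℕ) : ℝ) = (q - p) * q := by rw [Nat.cast_mul, Nat.cast_sub hpq.le]
  have hqp : (q : ℝ) / p ≤ ((q - p) * q : ℕ) := by
    refine (div_le_self hq'.le (by exact_mod_cast hp)).trans ?_
    exact_mod_cast Nat.le_mul_of_pos_left q (by omega)
  rcases Nat.even_or_odd (p * q) with h | h
  · obtain ⟨N, hN⟩ : ∃ N, p * q = N + 1 :=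
      Nat.exists_eq_succ_of_ne_zero (Nat.mul_pos hp (by omega)).ne'
    have hNc : (N : ℝ) = p * q - 1 := by
      rw [eq_sub_iff_add_eq]
      exact_mod_cast hN.symm
    refine ⟨N + 2, Fin.cons (2 * ((q - p) * q)) (Fin.cons (2 * ((q - p) * q))
      fun _ => (q - p) * q), ?_, ?_, ?_, ?_⟩
    · rw [hN] at h
      exact h.add even_two
    · refine Fin.cases (by simpa using hT) (Fin.cases (by simpa using hT) fun i => by simpa using hT)
    · simp only [Fin.sum_univ_succ, Fin.cons_zero, Fin.cons_succ, Finset.sum_const,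
        Finset.card_univ, Fintype.card_fin, nsmul_eq_mul, Nat.cast_mul 2, hTc, hNc]
      push_cast
      field_simp
      ring
    · have h2 : (q : ℝ) / p ≤ (2 * ((q - p) * q) : ℕ) :=
        hqp.trans (by exact_mod_cast Nat.le_mul_of_pos_left _ two_pos)
      exact Fin.cases h2 (Fin.cases h2 fun i => hqp)
  · refine ⟨p * q, fun _ => (q - p) * q, h.add_one, fun _ => hT, ?_, fun _ => hqp⟩
    simp only [Finset.sum_const, Finset.card_univ, Fintype.card_fin, nsmul_eq_mul, hTc]
    push_cast
    field_simp

end Beads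

theorem mainTheorem1 :
    -- the necklace graph has dependence `d(e₁) = p / q`, and is bipartite if `n = m + 1` is even
    (∀ p q : ℕ, 0 < p → p < q → ∀ (m : ℕ) (t : Fin m → ℕ), (∀ i, 0 < t i) →
      ∑ i, (1 : ℝ) / (t i : ℝ) = (p : ℝ) / ((q : ℝ) - (p : ℝ)) →
      (∀ i, (q : ℝ) / (p : ℝ) ≤ (t i : ℝ)) →
      ∀ u v : ∀ i : Fin (m + 1), Fin (sizeR t i) ⊕ Fin (sizeS t i),
        (∀ i, (bead t i).Adj (u i) (v i)) →
        (necklace (bead t) u v).Connected ∧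
        keyEdge u v 0 ∈ (necklace (bead t) u v).edgeSet ∧
        dependence (necklace (bead t) u v) = edgeDensity (necklace (bead t) u v) (keyEdge u v 0) ∧
        edgeDensity (necklace (bead t) u v) (keyEdge u v 0) = (p : ℝ) / (q : ℝ) ∧
        (Even (m + 1) → (necklace (bead t) u v).IsBipartite)) ∧
    -- the number `n = m + 1` of beads can be chosen even
    (∀ p q : ℕ, 0 < p → p < q → ∃ (m : ℕ) (t : Fin m → ℕ), Even (m + 1) ∧ (∀ i, 0 < t i) ∧
      ∑ i, (1 : ℝ) / (t i : ℝ) = (p : ℝ) / ((q : ℝ) - (p : ℝ)) ∧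
      (∀ i, (q : ℝ) / (p : ℝ) ≤ (t i : ℝ)) ∧
      ∃ u v : ∀ i : Fin (m + 1), Fin (sizeR t i) ⊕ Fin (sizeS t i),
        ∀ i, (bead t i).Adj (u i) (v i)) ∧
    -- every rational number in `(0, 1)` is the dependence of a bipartite graph
    (∀ p q : ℕ, 0 < p → p < q → ∃ (V : Type) (_ : Finite V) (G : SimpleGraph V),
      G.Connected ∧ G.IsBipartite ∧ dependence G = (p : ℝ) / (q : ℝ)) ∧
    -- Kahl's conjecture on the existence of a threshold `f(p, q)`
    (∃ f : ℕ → ℕ → ℕ, ∀ p q : ℕ, 0 < p → p < q → ∀ (m : ℕ) (t : Fin m → ℕ), (∀ i, 0 < t i) →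
      ∑ i, (1 : ℝ) / (t i : ℝ) = (p : ℝ) / ((q : ℝ) - (p : ℝ)) →
      (∀ i, f p q ≤ t i) →
      ∀ u v : ∀ i : Fin (m + 1), Fin (sizeR t i) ⊕ Fin (sizeS t i),
        (∀ i, (bead t i).Adj (u i) (v i)) →
        dependence (necklace (bead t) u v) =
          edgeDensity (necklace (bead t) u v) (keyEdge u v 0)) := by
  refine ⟨?_, ?_, ?_, fun _ q => q, ?_⟩
  · intro p q hp hpq m t ht hsum hle u v huv
    obtain ⟨h1, h2, h3, h4⟩ := dependence_necklace_bead hp hpq ht hsum hle huv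
    exact ⟨h1, h2, h3, h4, fun hm => necklace_isBipartite hm (bead_isBipartite t) huv⟩
  · intro p q hp hpq
    obtain ⟨m, t, hm, ht, hsum, hle⟩ := exists_odd_sum_one_div_eq hp hpq
    exact ⟨m, t, hm, ht, hsum, hle, exists_bead_adj ht⟩
  · intro p q hp hpq
    obtain ⟨m, t, hm, ht, hsum, hle⟩ := exists_odd_sum_one_div_eq hp hpq
    obtain ⟨u, v, huv⟩ := exists_bead_adj ht
    obtain ⟨h1, -, h3, h4⟩ := dependence_necklace_bead hp hpq ht hsum hle huv
    exact ⟨_, inferInstance, necklace (bead t) u v, h1,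
      necklace_isBipartite hm (bead_isBipartite t) huv, h3.trans h4⟩
  · intro p q hp hpq m t ht hsum hle u v huv
    refine (dependence_necklace_bead hp hpq ht hsum (fun i => ?_) huv).2.2.1
    -- `q ≥ q / p`, because `p ≥ 1`
    exact (div_le_self q.cast_nonneg (by exact_mod_cast hp)).trans (by exact_mod_cast hle i)
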